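/- Let $P$ be a finite set of points in the Euclidean plane. The $L_\infty$-Delaunay triangulation of $P$ (respectively the $L_1$-Delaunay triangulation of $P$) is the graph with vertex set $P$ in which two distinct points $u,v\in P$ are adjacent if and only if there is a non-degenerate square with sides parallel to the coordinate axes (respectively a non-degenerate tipped square, i.e. a square whose sides have slopes $\pm 1$) that has $u$ and $v$ on its boundary and contains no point of $P$ in its interior. Each edge is weighted by its Euclidean length. The stretch factor of a graph $H$ on $P$ is the least $t\in[0,\infty]$ such that for all $u,v\in P$ the length of a shortest path from $u$ to $v$ in $H$ ($\infty$ if there is none) is at most $t$ times the Euclidean distance of $u$ and $v$. (i) If no four points of $P$ lie on the boundary of an axis-parallel square and no two points of $P$ have the same abscissa or the same ordinate, then the stretch factor of the $L_\infty$-Delaunay triangulation of $P$ is at most $\sqrt{4+2\sqrt2}$. (ii) If no four points of $P$ lie on the boundary of a tipped square and no two points of $P$ lie on a common line of slope $1$ or $-1$, then the stretch factor of the $L_1$-Delaunay triangulation of $P$ is at most $\sqrt{4+2\sqrt2}$. -/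

import Mathlib

open scoped ENNReal

namespace SquareDelaunay

/-- The Euclidean plane; `dist` and `edist` on it are the Euclidean distance. -/
abbrev Plane : Type := EuclideanSpace ℝ (Fin 2)

/-- The `L_∞`-distance `max {d_x, d_y}`. -/
noncomputable def distInf (u w : Plane) : ℝ := max |u 0 - w 0| |u 1 - w 1|

/-- The `L_1`-distance `d_x + d_y`. -/
noncomputable def distOne (u w : Plane) : ℝ := |u 0 - w 0| + |u 1 - w 1|

/-- The boundary of the square with centre `c` and size `r`: for `d = distInf` this is the boundary
of the axis-parallel square of side `2 * r`, for `d = distOne` that of the square tipped at 45°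
whose diagonals have length `2 * r`. -/
def squareBoundary (d : Plane → Plane → ℝ) (c : Plane) (r : ℝ) : Set Plane := {p | d p c = r}

/-- The interior of the same square. -/
def squareInterior (d : Plane → Plane → ℝ) (c : Plane) (r : ℝ) : Set Plane := {p | d p c < r}

/-- The graph on `P` in which two distinct points are adjacent iff some (nondegenerate) square has
both on its boundary and no point of `P` in its interior. -/
def delaunay (d : Plane → Plane → ℝ) (P : Finset Plane) : SimpleGraph P where
  Adj u v := u ≠ v ∧ ∃ (c : Plane) (r : ℝ), 0 < r ∧
    (u : Plane) ∈ squareBoundary d c r ∧ (v : Plane) ∈ squareBoundary d c r ∧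
    ∀ w ∈ P, w ∉ squareInterior d c r
  symm := ⟨fun _ _ ⟨hne, c, r, hr, hu, hv, hw⟩ => ⟨hne.symm, c, r, hr, hv, hu, hw⟩⟩
  loopless := ⟨fun _ h => h.1 rfl⟩

/-- The `L_∞`-Delaunay triangulation (axis-parallel squares). -/
noncomputable def delaunayInf (P : Finset Plane) : SimpleGraph P := delaunay distInf P

/-- The `L_1`-Delaunay triangulation (tipped squares). -/
noncomputable def delaunayOne (P : Finset Plane) : SimpleGraph P := delaunay distOne P

/-- No four points of `P` lie on the boundary of a square. -/
def NoFourOnSquare (d : Plane → Plane → ℝ) (P : Finset Plane) : Prop :=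
  ∀ Q : Finset Plane, Q ⊆ P → Q.card = 4 →
    ∀ (c : Plane) (r : ℝ), 0 < r → ¬ ((Q : Set Plane) ⊆ squareBoundary d c r)

/-- General position for the `L_∞`-Delaunay triangulation: no four points on the boundary of an
axis-parallel square, no two points with the same abscissa or the same ordinate. -/
def GeneralPositionInf (P : Finset Plane) : Prop :=
  NoFourOnSquare distInf P ∧
    ∀ u ∈ P, ∀ v ∈ P, u ≠ v → u 0 ≠ v 0 ∧ u 1 ≠ v 1

/-- General position for the `L_1`-Delaunay triangulation (the same condition turned by 45°): no
four points on the boundary of a tipped square, no two points on a line of slope `1` or `-1`. -/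
def GeneralPositionOne (P : Finset Plane) : Prop :=
  NoFourOnSquare distOne P ∧
    ∀ u ∈ P, ∀ v ∈ P, u ≠ v → u 0 + u 1 ≠ v 0 + v 1 ∧ u 0 - u 1 ≠ v 0 - v 1

/-- Euclidean length of a walk in a graph on `P`. -/
noncomputable def walkLength {P : Finset Plane} {G : SimpleGraph P} {u v : P}
    (p : G.Walk u v) : ℝ≥0∞ :=
  (p.darts.map fun e => edist (e.fst : Plane) (e.snd : Plane)).sum

/-- Distance in `G`, edges weighted by Euclidean length; it is `∞` if no walk joins `u` and `v`. -/
noncomputable def graphDist {P : Finset Plane} (G : SimpleGraph P) (u v : P) : ℝ≥0∞ :=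
  ⨅ p : G.Walk u v, walkLength p

/-- `H` is a `t`-spanner of `G`. -/
def IsSpannerOf {P : Finset Plane} (H G : SimpleGraph P) (t : ℝ≥0∞) : Prop :=
  H ≤ G ∧ ∀ u v : P, graphDist H u v ≤ t * graphDist G u v

/-- The stretch factor of `H` with respect to the complete Euclidean graph `⊤`: the least `t`
such that `H` is a `t`-spanner of it. -/
noncomputable def stretchFactor {P : Finset Plane} (H : SimpleGraph P) : ℝ≥0∞ :=
  sInf {t : ℝ≥0∞ | IsSpannerOf H ⊤ t}

end SquareDelaunay

namespace SquareDelaunay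

/-! The constant is the Euclidean norm of (1 + √2, 1). By Cauchy–Schwarz (`bound_le`) it suffices to
join points with coordinate differences x ≥ y ≥ 0 by a path of length at most (1 + √2)x + y
(`Net.path`). An isometry makes tipped squares axis-parallel, so both parts are instances of one
statement about a `Net`, which can be reflected freely.

The claim is proved by induction on the L∞-distance of a and b. If their rectangle contains a third
point, the path splits (`Net.path_of_mem`). Otherwise every point with abscissa strictly between
theirs lies above both or below both. Unless ab is an edge, empty squares sweep from a towards b,
each with a point h above and a point l below on its boundary. The invariant of a `Front` is that
the paths to h and l, together with the boundary arc from h over the right side to l, have total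
length at most 4(e - a.1), where e is the abscissa of the right side. Hence a point p that the right
side meets is reached, by the better way round, within 2(p.1 - a.1). For p = b this is enough, as 2
≤ 1 + √2.

The sweep stops early only at a gentle edge between a lower and an upper point, one wider than high.
Its length is at most √2 times its width, which leaves enough to pay for the final way to b
(`Corridor.of_gentle`, `Corridor.of_descending`). -/

/-- `p` lies on the boundary of the square `[w, w + s] × [t, t + s]`. -/
def OnSquare (w t s : ℝ) (p : ℝ × ℝ) : Prop :=
  (w ≤ p.1 ∧ p.1 ≤ w + s) ∧ (t ≤ p.2 ∧ p.2 ≤ t + s) ∧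
    (p.1 = w ∨ p.1 = w + s ∨ p.2 = t ∨ p.2 = t + s)

/-- No point of `P` lies in the open rectangle `(w, e) × (t, n)`. -/
def EmptyBox (P : Set (ℝ × ℝ)) (w e t n : ℝ) : Prop :=
  ∀ q ∈ P, w < q.1 → q.1 < e → t < q.2 → q.2 < n → False

/-- A finite point set without two points on a horizontal or vertical line, together with a
relation `D u v r` ("there is a path of length at most `r` from `u` to `v`") that contains the
edges of the `L_∞`-Delaunay triangulation. -/
structure Net (P : Set (ℝ × ℝ)) (D : ℝ × ℝ → ℝ × ℝ → ℝ → Prop) : Prop where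
  finite : P.Finite
  fst_inj : ∀ p ∈ P, ∀ q ∈ P, p.1 = q.1 → p = q
  snd_inj : ∀ p ∈ P, ∀ q ∈ P, p.2 = q.2 → p = q
  refl : ∀ u ∈ P, D u u 0
  mono : ∀ u v r s, D u v r → r ≤ s → D u v s
  symm : ∀ u v r, D u v r → D v u r
  trans : ∀ u v w r s, D u v r → D v w s → D u w (r + s)
  -- Two upper bounds for the Euclidean length: the L1 bound is additive along monotone paths, the
  -- √2·L∞ bound is the better one on gentle edges.
  edge_one : ∀ u ∈ P, ∀ v ∈ P, ∀ w t s, 0 < s → OnSquare w t s u → OnSquare w t s v →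
    EmptyBox P w (w + s) t (t + s) → D u v (|u.1 - v.1| + |u.2 - v.2|)
  edge_inf : ∀ u ∈ P, ∀ v ∈ P, ∀ w t s, 0 < s → OnSquare w t s u → OnSquare w t s v →
    EmptyBox P w (w + s) t (t + s) → D u v (√2 * max |u.1 - v.1| |u.2 - v.2|)

/-! ### Reflections of nets -/

/-- Reflection at the horizontal axis. -/
def flip (p : ℝ × ℝ) : ℝ × ℝ := (p.1, -p.2)

@[simp] lemma flip_fst (p : ℝ × ℝ) : (flip p).1 = p.1 := rfl
@[simp] lemma flip_snd (p : ℝ × ℝ) : (flip p).2 = -p.2 := rfl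
@[simp] lemma flip_flip (p : ℝ × ℝ) : flip (flip p) = p := by ext <;> simp

lemma abs_flip_snd_sub (u v : ℝ × ℝ) : |(flip u).2 - (flip v).2| = |u.2 - v.2| := by
  simp only [flip_snd]; rw [← abs_neg]; congr 1; ring

variable {P : Set (ℝ × ℝ)} {D : ℝ × ℝ → ℝ × ℝ → ℝ → Prop}

lemma OnSquare.flip {w t s : ℝ} {p : ℝ × ℝ} (h : OnSquare w t s p) :
    OnSquare w (-t - s) s (flip p) := by
  obtain ⟨h1, h2, h3⟩ := h
  refine ⟨h1, ⟨?_, ?_⟩, ?_⟩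
  · simp only [flip_snd]; linarith
  · simp only [flip_snd]; linarith
  · simp only [flip_snd, flip_fst]
    rcases h3 with h | h | h | h
    · exact Or.inl h
    · exact Or.inr (Or.inl h)
    · exact Or.inr (Or.inr (Or.inr (by linarith)))
    · exact Or.inr (Or.inr (Or.inl (by linarith)))

lemma EmptyBox.flip {w e t n : ℝ} (h : EmptyBox P w e t n) :
    EmptyBox (flip ⁻¹' P) w e (-n) (-t) := fun q hq h1 h2 h3 h4 =>
  h _ hq h1 h2 (by simp only [flip_snd]; linarith) (by simp only [flip_snd]; linarith)

lemma EmptyBox.of_flip {w e t n : ℝ} (h : EmptyBox (SquareDelaunay.flip ⁻¹' P) w e t n) :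
    EmptyBox P w e (-n) (-t) := fun q hq h1 h2 h3 h4 =>
  h (SquareDelaunay.flip q) (by simpa using hq) h1 h2
    (by simp only [flip_snd]; linarith) (by simp only [flip_snd]; linarith)

lemma EmptyBox.mono {w e t n w' e' t' n' : ℝ} (h : EmptyBox P w e t n)
    (hw : w ≤ w') (he : e' ≤ e) (ht : t ≤ t') (hn : n' ≤ n) : EmptyBox P w' e' t' n' :=
  fun q hq h1 h2 h3 h4 => h q hq (by linarith) (by linarith) (by linarith) (by linarith)

namespace Net

lemma edge_le (N : Net P D) {u v : ℝ × ℝ} (hu : u ∈ P) (hv : v ∈ P) {w t s r : ℝ} (hs : 0 < s)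
    (hu' : OnSquare w t s u) (hv' : OnSquare w t s v) (he : EmptyBox P w (w + s) t (t + s))
    (hr : |u.1 - v.1| + |u.2 - v.2| ≤ r) : D u v r :=
  N.mono _ _ _ _ (N.edge_one u hu v hv w t s hs hu' hv' he) hr

lemma flip (N : Net P D) :
    Net (flip ⁻¹' P) (fun u v => D (SquareDelaunay.flip u) (SquareDelaunay.flip v)) where
  finite := N.finite.preimage fun x _ y _ h => by simpa using congrArg SquareDelaunay.flip h
  fst_inj p hp q hq h := by
    simpa using congrArg SquareDelaunay.flip (N.fst_inj _ hp _ hq (by simpa using h))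
  snd_inj p hp q hq h := by
    simpa using congrArg SquareDelaunay.flip (N.snd_inj _ hp _ hq (by simpa using h))
  refl u hu := N.refl _ hu
  mono u v r s := N.mono _ _ r s
  symm u v r := N.symm _ _ r
  trans u v w r s := N.trans _ _ _ r s
  edge_one u hu v hv w t s hs h1 h2 he := by
    have := N.edge_one _ hu _ hv w (-t - s) s hs h1.flip h2.flip
      (he.of_flip.mono le_rfl le_rfl (by linarith) (by linarith))
    rwa [abs_flip_snd_sub] at this
  edge_inf u hu v hv w t s hs h1 h2 he := by
    have := N.edge_inf _ hu _ hv w (-t - s) s hs h1.flip h2.flip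
      (he.of_flip.mono le_rfl le_rfl (by linarith) (by linarith))
    rwa [abs_flip_snd_sub] at this

lemma swap (N : Net P D) :
    Net (Prod.swap ⁻¹' P) (fun u v => D u.swap v.swap) where
  finite := N.finite.preimage Prod.swap_injective.injOn
  fst_inj p hp q hq h := Prod.swap_injective (N.snd_inj _ hp _ hq h)
  snd_inj p hp q hq h := Prod.swap_injective (N.fst_inj _ hp _ hq h)
  refl u hu := N.refl _ hu
  mono u v r s := N.mono _ _ r s
  symm u v r := N.symm _ _ r
  trans u v w r s := N.trans _ _ _ r s
  edge_one u hu v hv w t s hs h1 h2 he := by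
    have := N.edge_one _ hu _ hv t w s hs ⟨h1.2.1, h1.1, by have := h1.2.2; simp; tauto⟩
      ⟨h2.2.1, h2.1, by have := h2.2.2; simp; tauto⟩
      (fun q hq a b c d => he q.swap (by simpa using hq) c d a b)
    rw [add_comm]; exact this
  edge_inf u hu v hv w t s hs h1 h2 he := by
    have := N.edge_inf _ hu _ hv t w s hs ⟨h1.2.1, h1.1, by have := h1.2.2; simp; tauto⟩
      ⟨h2.2.1, h2.1, by have := h2.2.2; simp; tauto⟩
      (fun q hq a b c d => he q.swap (by simpa using hq) c d a b)
    rw [max_comm]; exact this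

end Net

/-- An ascent along a finite set reaches `goal`. -/
lemma of_ascent {α : Type*} {T : Set α} (hT : T.Finite) (hne : T.Nonempty) (f : α → ℝ)
    {goal : Prop} (h : ∀ x ∈ T, goal ∨ ∃ y ∈ T, f x < f y) : goal := by
  obtain ⟨x, hx, hmax⟩ := Set.exists_max_image T f hT hne
  rcases h x hx with h | ⟨y, hy, hlt⟩
  · exact h
  · exact absurd (hmax y hy) (not_le.mpr hlt)

/-! ### The inductive bound and corridors -/

/-- The bound on the length of a shortest path between `u` and `v`. -/
noncomputable def bound (u v : ℝ × ℝ) : ℝ :=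
  |u.1 - v.1| + |u.2 - v.2| + √2 * max |u.1 - v.1| |u.2 - v.2|

/-- The bound holds for all pairs at `L_∞`-distance less than `δ`. -/
def BoundBelow (P : Set (ℝ × ℝ)) (D : ℝ × ℝ → ℝ × ℝ → ℝ → Prop) (δ : ℝ) : Prop :=
  ∀ c ∈ P, ∀ d ∈ P, |c.1 - d.1| < δ → |c.2 - d.2| < δ → D c d (bound c d)

lemma bound_flip (u v : ℝ × ℝ) : bound (flip u) (flip v) = bound u v := by
  rw [bound, bound, abs_flip_snd_sub, flip_fst, flip_fst]

lemma BoundBelow.flip {δ : ℝ} (h : BoundBelow P D δ) :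
    BoundBelow (flip ⁻¹' P) (fun u v => D (SquareDelaunay.flip u) (SquareDelaunay.flip v)) δ := by
  intro c hc d hd h1 h2
  rw [← bound_flip]
  exact h _ hc _ hd h1 (by rwa [abs_flip_snd_sub])

lemma BoundBelow.swap {δ : ℝ} (h : BoundBelow P D δ) :
    BoundBelow (Prod.swap ⁻¹' P) (fun u v => D u.swap v.swap) δ := by
  intro c hc d hd h1 h2
  have := h _ hc _ hd h2 h1
  rw [bound, add_comm |c.1 - d.1|, max_comm]; exact this

/-- The rectangle spanned by `a` and `b` contains no further point; it is at least as wide as high,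
and the bound is known for all pairs that are closer than `a` and `b`. -/
structure Corridor (P : Set (ℝ × ℝ)) (D : ℝ × ℝ → ℝ × ℝ → ℝ → Prop) (a b : ℝ × ℝ) : Prop where
  net : Net P D
  ha : a ∈ P
  hb : b ∈ P
  lt : a.1 < b.1
  up : b.2 - a.2 ≤ b.1 - a.1
  down : a.2 - b.2 ≤ b.1 - a.1
  sides : ∀ q ∈ P, a.1 < q.1 → q.1 < b.1 → (a.2 < q.2 ∧ b.2 < q.2) ∨ (q.2 < a.2 ∧ q.2 < b.2)
  ih : BoundBelow P D (b.1 - a.1)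

lemma Corridor.flip {a b : ℝ × ℝ} (C : Corridor P D a b) :
    Corridor (flip ⁻¹' P) (fun u v => D (SquareDelaunay.flip u) (SquareDelaunay.flip v))
      (SquareDelaunay.flip a) (SquareDelaunay.flip b) where
  net := C.net.flip
  ha := by simpa using C.ha
  hb := by simpa using C.hb
  lt := C.lt
  up := by have := C.down; simp only [flip_fst, flip_snd]; linarith
  down := by have := C.up; simp only [flip_fst, flip_snd]; linarith
  sides q hq h1 h2 := by
    simp only [flip_snd]
    rcases C.sides _ hq h1 h2 with h | h <;> simp only [flip_snd] at h
    · exact Or.inr ⟨by linarith, by linarith⟩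
    · exact Or.inl ⟨by linarith, by linarith⟩
  ih := C.ih.flip

/-- The bound on the distance of the endpoints of a corridor. -/
noncomputable def corridorBound (a b : ℝ × ℝ) : ℝ := (1 + √2) * (b.1 - a.1) + |b.2 - a.2|

lemma corridorBound_flip (a b : ℝ × ℝ) : corridorBound (flip a) (flip b) = corridorBound a b := by
  simp only [corridorBound, flip_fst, flip_snd]
  rw [← abs_neg (b.2 - a.2)]; congr 2; ring

/-! ### Leaving the sweep: gentle edges and the descent to b -/

/-- Every edge of the descent is charged its L1-length: the term -(h.2 - a.2) pays for the loss of
height, the other one for the progress to the right. Once the slope from h to b is at most 1 in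
absolute value, the induction hypothesis finishes. -/
lemma Corridor.of_descending {a b h : ℝ × ℝ} (C : Corridor P D a b) (hh : h ∈ P) (h1 : a.1 < h.1)
    (h1' : h.1 < b.1) (h2 : b.2 < h.2) (he : EmptyBox P (h.1 - (h.2 - b.2)) h.1 b.2 h.2)
    (hD : D a h ((1 + √2) * (h.1 - a.1) - (h.2 - a.2))) : D a b (corridorBound a b) := by
  have N := C.net
  have hsq : 0 ≤ √2 := Real.sqrt_nonneg 2
  refine of_ascent (T := {h | h ∈ P ∧ a.1 < h.1 ∧ h.1 < b.1 ∧ b.2 < h.2 ∧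
    EmptyBox P (h.1 - (h.2 - b.2)) h.1 b.2 h.2 ∧ D a h ((1 + √2) * (h.1 - a.1) - (h.2 - a.2))})
    (N.finite.subset fun x hx => hx.1) ⟨h, hh, h1, h1', h2, he, hD⟩ Prod.fst ?_
  clear! h
  rintro h ⟨hh, h1, h1', h2, he, hD⟩
  rcases le_or_gt (h.2 - b.2) (b.1 - h.1) with hg | hg
  · left
    have e1 : |h.1 - b.1| = b.1 - h.1 := by rw [abs_sub_comm]; exact abs_of_pos (by linarith)
    have e2 : |h.2 - b.2| = h.2 - b.2 := abs_of_pos (by linarith)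
    have := C.ih h hh b C.hb (by rw [e1]; linarith) (by rw [e2]; linarith)
    rw [bound, e1, e2, max_eq_left hg] at this
    refine N.mono _ _ _ _ (N.trans _ _ _ _ _ hD this) ?_
    rw [corridorBound]
    have := neg_abs_le (b.2 - a.2)
    nlinarith
  -- The square with top at the height of h and right side through this p is empty: left of h it
  -- stays inside the box `he`, right of h it ends at the first point p.
  · obtain ⟨p, ⟨hp, hp1, hp2, hp3⟩, hmin⟩ := Set.exists_min_image
      {q | q ∈ P ∧ h.1 < q.1 ∧ b.2 ≤ q.2 ∧ q.2 ≤ h.2} Prod.fst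
      (N.finite.subset fun x hx => hx.1) ⟨b, C.hb, h1', le_rfl, h2.le⟩
    have hpb : p.1 ≤ b.1 := hmin b ⟨C.hb, h1', le_rfl, h2.le⟩
    have hph : p.2 < h.2 := lt_of_le_of_ne hp3 fun e => by
      have := N.snd_inj _ hp _ hh e
      rw [this] at hp1; exact lt_irrefl _ hp1
    have hs : max (h.2 - p.2) (p.1 - h.1) ≤ h.2 - b.2 := max_le (by linarith) (by linarith)
    have hs1 := le_max_left (h.2 - p.2) (p.1 - h.1)
    have hs2 := le_max_right (h.2 - p.2) (p.1 - h.1)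
    set s := max (h.2 - p.2) (p.1 - h.1)
    have hE : EmptyBox P (p.1 - s) (p.1 - s + s) (h.2 - s) (h.2 - s + s) := by
      intro q hq q1 q2 q3 q4
      rcases lt_trichotomy q.1 h.1 with hlt | heq | hgt
      · exact he q hq (by linarith) hlt (by linarith) (by linarith)
      · have := N.fst_inj _ hq _ hh heq
        rw [this] at q4; linarith
      · have := hmin q ⟨hq, hgt, by linarith, by linarith⟩
        linarith
    have hedge : D h p ((p.1 - h.1) + (h.2 - p.2)) := by
      refine N.edge_le hh hp (by linarith) ⟨⟨by linarith, by linarith⟩,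
        ⟨by linarith, by linarith⟩, Or.inr (Or.inr (Or.inr (by ring)))⟩
        ⟨⟨by linarith, by linarith⟩, ⟨by linarith, by linarith⟩, Or.inr (Or.inl (by ring))⟩ hE ?_
      rw [abs_sub_comm, abs_of_pos (by linarith : 0 < p.1 - h.1),
        abs_of_pos (by linarith : 0 < h.2 - p.2)]
    have hDp := N.trans _ _ _ _ _ hD hedge
    by_cases hpeq : p = b
    · left
      subst hpeq
      refine N.mono _ _ _ _ hDp ?_
      rw [corridorBound]
      have := neg_abs_le (p.2 - a.2)
      nlinarith
    · right
      have hpb1 : p.1 < b.1 := lt_of_le_of_ne hpb fun e => hpeq (N.fst_inj _ hp _ C.hb e)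
      have hpb2 : b.2 < p.2 := lt_of_le_of_ne hp2 fun e => hpeq (N.snd_inj _ hp _ C.hb e.symm)
      refine ⟨p, ⟨hp, by linarith, hpb1, hpb2, ?_, N.mono _ _ _ _ hDp (by nlinarith)⟩, hp1⟩
      intro q hq q1 q2 q3 q4
      rcases lt_trichotomy q.1 h.1 with hlt | heq | hgt
      · exact he q hq (by linarith) hlt (by linarith) (by linarith)
      · have := N.fst_inj _ hq _ hh heq
        rw [this] at q4; linarith
      · have := hmin q ⟨hq, hgt, by linarith, by linarith⟩
        linarith

/-- Of the budget 1 + √2 per unit of abscissa, the gentle edge uses √2; the remaining 1 pays for its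
height. Up to l the budget 2 ≤ 1 + √2 was respected, so the invariant of `of_descending` holds at h.
-/
lemma Corridor.of_gentle {a b h l : ℝ × ℝ} (C : Corridor P D a b) (hh : h ∈ P) (hl1 : a.1 < l.1)
    (h1 : h.1 < b.1) (h2 : b.2 < h.2) (hl2 : l.2 < b.2)
    (hg : h.2 - l.2 ≤ h.1 - l.1) (he : EmptyBox P l.1 h.1 l.2 h.2)
    {r : ℝ} (hr : r + (l.2 - a.2) ≤ 2 * (l.1 - a.1)) (hD : D a l r)
    (hlh : D l h (√2 * max |l.1 - h.1| |l.2 - h.2|)) : D a b (corridorBound a b) := by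
  have e1 : |l.1 - h.1| = h.1 - l.1 := by rw [abs_sub_comm]; exact abs_of_pos (by linarith)
  have e2 : |l.2 - h.2| = h.2 - l.2 := by rw [abs_sub_comm]; exact abs_of_pos (by linarith)
  rw [e1, e2, max_eq_left hg] at hlh
  have hsq : 1 ≤ √2 := by rw [Real.one_le_sqrt]; norm_num
  refine C.of_descending hh (by linarith) h1 h2 (he.mono (by linarith) le_rfl hl2.le le_rfl)
    (C.net.mono _ _ _ _ (C.net.trans _ _ _ _ _ hD hlh) ?_)
  nlinarith

/-! ### Fronts and the sweep -/

/-- The points `h` and `l` lie above and below the corridor from `a` to `b`, on the top and bottom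
sides of an empty square whose right side has abscissa `e`; paths of length `r` and `s` lead from
`a` to `h` and `l`, and there is enough potential left to cross the square to the right. -/
structure Front (P : Set (ℝ × ℝ)) (D : ℝ × ℝ → ℝ × ℝ → ℝ → Prop) (a b h l : ℝ × ℝ)
    (e r s : ℝ) : Prop where
  hh : h ∈ P
  hl : l ∈ P
  a_lt_h : a.1 < h.1
  h_lt_b : h.1 < b.1
  a_lt_l : a.1 < l.1
  l_lt_b : l.1 < b.1
  a_below : a.2 < h.2
  b_below : b.2 < h.2
  a_above : l.2 < a.2
  b_above : l.2 < b.2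
  h_le : h.1 ≤ e
  l_le : l.1 ≤ e
  e_le : e ≤ b.1
  le_h : e - (h.2 - l.2) ≤ h.1
  le_l : e - (h.2 - l.2) ≤ l.1
  empty : EmptyBox P (e - (h.2 - l.2)) e l.2 h.2
  path_h : D a h r
  path_l : D a l s
  -- Equivalently, r + s + (e - h.1) + (h.2 - l.2) + (e - l.1) ≤ 4(e - a.1): the two paths plus the
  -- boundary arc over the right side.
  potential : r + s ≤ h.1 + l.1 - 2 * a.1 - (h.2 - l.2) + 2 * (e - a.1)
  -- This and `s_le` are what `of_gentle` requires when the sweep ends with a gentle edge at h or l.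
  r_le : r - (h.2 - a.2) ≤ 2 * (h.1 - a.1)
  s_le : s - (a.2 - l.2) ≤ 2 * (l.1 - a.1)

/-- There is a front further to the right, or the corridor has been crossed. -/
def Advances (P : Set (ℝ × ℝ)) (D : ℝ × ℝ → ℝ × ℝ → ℝ → Prop) (a b : ℝ × ℝ) (x : ℝ) : Prop :=
  D a b (corridorBound a b) ∨
    ∃ h l : ℝ × ℝ, (∃ e r s, Front P D a b h l e r s) ∧ x < h.1 + l.1

lemma Front.flip {a b h l : ℝ × ℝ} {e r s : ℝ} (F : Front P D a b h l e r s) :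
    Front (flip ⁻¹' P) (fun u v => D (SquareDelaunay.flip u) (SquareDelaunay.flip v))
      (SquareDelaunay.flip a) (SquareDelaunay.flip b) (SquareDelaunay.flip l)
      (SquareDelaunay.flip h) e s r := by
  obtain ⟨_, _, _, _, _, _, _, _, _, _, _, _, _, _, _, hem, _, _, _, _, _⟩ := F
  constructor
  case empty =>
    exact hem.flip.mono (by simp only [flip_snd]; linarith) le_rfl le_rfl le_rfl
  case hh => simpa
  case hl => simpa
  case path_h => simpa
  case path_l => simpa
  all_goals simp only [flip_fst, flip_snd]; linarith

lemma flip_preimage_preimage (P : Set (ℝ × ℝ)) : flip ⁻¹' (flip ⁻¹' P) = P := by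
  ext; simp

lemma Advances.of_flip {a b : ℝ × ℝ} {x : ℝ}
    (h : Advances (flip ⁻¹' P) (fun u v => D (flip u) (flip v)) (flip a) (flip b) x) :
    Advances P D a b x := by
  rcases h with h | ⟨h, l, ⟨e, r, s, F⟩, hlt⟩
  · left
    simpa only [corridorBound_flip, flip_flip] using h
  · right
    refine ⟨SquareDelaunay.flip l, SquareDelaunay.flip h, ⟨e, s, r, ?_⟩, by simpa [add_comm]⟩
    simpa only [flip_flip, flip_preimage_preimage] using F.flip

namespace Corridor

/-- Here p takes the place of h. The square between the heights of l and p with right side through p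
lies in the given empty one. If it extends far enough to the left to contain l, it carries a new
front; if not, the edge from l to p is gentle. -/
lemma advances_of_above {a b h l p : ℝ × ℝ} {r s : ℝ} (C : Corridor P D a b)
    (hl : l ∈ P) (hp : p ∈ P) (hal : a.1 < l.1) (hlb : l.1 < b.1)
    (ha2 : l.2 < a.2) (hb2 : l.2 < b.2) (hDl : D a l s) (hs : s - (a.2 - l.2) ≤ 2 * (l.1 - a.1))
    (hpb : p.1 < b.1) (hpa2 : a.2 < p.2) (hpb2 : b.2 < p.2) (hhp : h.1 < p.1)
    {w t d : ℝ} (hd : 0 < d) (hE : EmptyBox P w (w + d) t (t + d)) (hpS : OnSquare w t d p)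
    (hlS : OnSquare w t d l) (hpw : p.1 = w + d) (hDp : D a p r) (hr : r ≤ 2 * (p.1 - a.1))
    (hrs : r + s ≤ 4 * (p.1 - a.1) - (p.1 - l.1) - (p.2 - l.2)) :
    Advances P D a b (h.1 + l.1) := by
  have hlS1 := hlS.1.1
  have hlS2 := hlS.1.2
  have hlS3 := hlS.2.1.1
  have hpS3 := hpS.2.1.2
  rcases le_or_gt (p.1 - (p.2 - l.2)) l.1 with hle | hlt
  · right
    refine ⟨p, l, ⟨p.1, r, s, ?_⟩, by linarith⟩
    constructor
    case empty => exact hE.mono (by linarith) (by linarith) (by linarith) (by linarith)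
    case path_h => exact hDp
    case path_l => exact hDl
    case hh => exact hp
    case hl => exact hl
    all_goals linarith
  · left
    exact C.of_gentle hp hal hpb hpb2 hb2 (by linarith)
      (hE.mono hlS1 (by linarith) hlS3 hpS3) (by linarith) hDl
      (C.net.edge_inf _ hl _ hp w t d hd hlS hpS hE)

/-- An empty square through `h`, `l` and a point `p` on its right side lets the front advance. -/
lemma advances_of_east {a b h l p : ℝ × ℝ} {e r s : ℝ} (C : Corridor P D a b)
    (F : Front P D a b h l e r s) (hp : p ∈ P) (hpb : p.1 ≤ b.1) (hhp : h.1 < p.1)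
    (hlp : l.1 < p.1) {w t d : ℝ} (hd : 0 < d) (hE : EmptyBox P w (w + d) t (t + d))
    (hhS : OnSquare w t d h) (hpS : OnSquare w t d p) (hlS : OnSquare w t d l)
    (hpw : p.1 = w + d)
    (hkey : r + s + (p.1 - h.1) + |h.2 - p.2| + (p.1 - l.1) + |l.2 - p.2| ≤ 4 * (p.1 - a.1)) :
    Advances P D a b (h.1 + l.1) := by
  have N := C.net
  have e1 : |h.1 - p.1| = p.1 - h.1 := by rw [abs_sub_comm]; exact abs_of_pos (by linarith)
  have e2 : |l.1 - p.1| = p.1 - l.1 := by rw [abs_sub_comm]; exact abs_of_pos (by linarith)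
  have D1 := N.trans _ _ _ _ _ F.path_h (N.edge_one _ F.hh _ hp w t d hd hhS hpS hE)
  have D2 := N.trans _ _ _ _ _ F.path_l (N.edge_one _ F.hl _ hp w t d hd hlS hpS hE)
  rw [e1] at D1
  rw [e2] at D2
  -- The ways to p via h and via l have total length at most 4(p.1 - a.1) by `hkey`, so the shorter
  -- one is within 2(p.1 - a.1).
  have hD : D a p (min (r + (p.1 - h.1 + |h.2 - p.2|)) (s + (p.1 - l.1 + |l.2 - p.2|))) := by
    rcases min_choice (r + (p.1 - h.1 + |h.2 - p.2|)) (s + (p.1 - l.1 + |l.2 - p.2|)) with h | h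
    · rwa [h]
    · rwa [h]
  have m1 := min_le_left (r + (p.1 - h.1 + |h.2 - p.2|)) (s + (p.1 - l.1 + |l.2 - p.2|))
  have m2 := min_le_right (r + (p.1 - h.1 + |h.2 - p.2|)) (s + (p.1 - l.1 + |l.2 - p.2|))
  set c := min (r + (p.1 - h.1 + |h.2 - p.2|)) (s + (p.1 - l.1 + |l.2 - p.2|))
  by_cases hpeq : p = b
  · left
    subst hpeq
    refine N.mono _ _ _ _ hD ?_
    have hsq : 1 ≤ √2 := by rw [Real.one_le_sqrt]; norm_num
    have := abs_nonneg (p.2 - a.2)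
    have := C.lt
    rw [corridorBound]
    nlinarith
  have hpb1 : p.1 < b.1 := lt_of_le_of_ne hpb fun e => hpeq (N.fst_inj _ hp _ C.hb e)
  have hah := F.a_lt_h
  have hab1 := F.a_below
  have hab2 := F.a_above
  have hcr := F.r_le
  have hcs := F.s_le
  have hb1 := F.b_below
  have hb2 := F.b_above
  rcases C.sides p hp (by linarith) hpb1 with ⟨q1, q2⟩ | ⟨q1, q2⟩
  · have e3 : |l.2 - p.2| = p.2 - l.2 := by rw [abs_sub_comm]; exact abs_of_pos (by linarith)
    rw [e3] at hkey m2
    exact C.advances_of_above F.hl hp F.a_lt_l F.l_lt_b F.a_above F.b_above F.path_l F.s_le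
      hpb1 q1 q2 hhp hd hE hpS hlS hpw hD (by linarith) (by linarith)
  · have e3 : |h.2 - p.2| = h.2 - p.2 := abs_of_pos (by linarith)
    rw [e3] at hkey m1
    have F' := F.flip
    rw [add_comm]
    refine Advances.of_flip ?_
    refine C.flip.advances_of_above (p := SquareDelaunay.flip p) (h := SquareDelaunay.flip l)
      (l := SquareDelaunay.flip h) (r := c)
      F'.hl (by simpa using hp) F'.a_lt_l F'.l_lt_b F'.a_above F'.b_above F'.path_l F'.s_le
      hpb1 (by simpa using q1) (by simpa using q2) hlp hd
      (hE.flip.mono le_rfl le_rfl (by linarith) (by linarith)) hpS.flip hhS.flip hpw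
      (by simpa using hD) (by simp only [flip_fst]; linarith) ?_
    simp only [flip_fst, flip_snd]; linarith

/-- The sliding square loses h through its left side before reaching p. So it is instead grown with
lower left corner fixed at (h.1, l.2) until it meets a point q: either on its right side, or on its
top, where q succeeds h. -/
lemma advances_of_far {a b h l p : ℝ × ℝ} {e r s : ℝ} (C : Corridor P D a b)
    (F : Front P D a b h l e r s) (hhl : h.1 ≤ l.1) (hpe : h.1 + (h.2 - l.2) < p.1)
    (hpb : p.1 ≤ b.1)
    (hmin : ∀ q ∈ P, l.2 < q.2 → q.2 < h.2 → e ≤ q.1 → p.1 ≤ q.1) :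
    Advances P D a b (h.1 + l.1) := by
  have N := C.net
  have hb1 := F.b_below
  have hb2 := F.b_above
  obtain ⟨q, ⟨hq, hq1, hq2⟩, hqmin⟩ := Set.exists_min_image
    {q | q ∈ P ∧ h.1 < q.1 ∧ l.2 < q.2} (fun q => max (q.1 - h.1) (q.2 - l.2))
    (N.finite.subset fun x hx => hx.1) ⟨b, C.hb, F.h_lt_b, F.b_above⟩
  have hqb : max (q.1 - h.1) (q.2 - l.2) ≤ b.1 - h.1 :=
    (hqmin b ⟨C.hb, F.h_lt_b, F.b_above⟩).trans (max_le le_rfl (by linarith))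
  have hd1 := le_max_left (q.1 - h.1) (q.2 - l.2)
  have hd2 := le_max_right (q.1 - h.1) (q.2 - l.2)
  have hdc := max_choice (q.1 - h.1) (q.2 - l.2)
  set d := max (q.1 - h.1) (q.2 - l.2)
  -- A smaller square would put q inside the old empty square or in the gap before p.
  have hd : h.2 - l.2 ≤ d := by
    by_contra hlt
    push Not at hlt
    rcases lt_or_ge q.1 e with hqe | hqe
    · exact F.empty q hq (by linarith [F.le_h]) hqe hq2 (by linarith)
    · linarith [hmin q hq hq2 (by linarith) hqe]
  have hd0 : 0 < d := by linarith
  have hE : EmptyBox P h.1 (h.1 + d) l.2 (l.2 + d) := by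
    intro x hx x1 x2 x3 x4
    have := hqmin x ⟨hx, x1, x3⟩
    exact absurd this (not_le.mpr (max_lt (by linarith) (by linarith)))
  have hpot := F.potential
  have hleh := F.le_h
  have hle := F.l_le
  have hhS : OnSquare h.1 l.2 d h :=
    ⟨⟨le_rfl, by linarith⟩, ⟨by linarith, by linarith⟩, Or.inl rfl⟩
  have hlS : OnSquare h.1 l.2 d l :=
    ⟨⟨hhl, by linarith⟩, ⟨le_rfl, by linarith⟩, Or.inr (Or.inr (Or.inl rfl))⟩
  rcases eq_or_lt_of_le (show q.1 ≤ h.1 + d by linarith) with heq | hlt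
  · have hlq : l.1 < q.1 := by
      refine lt_of_le_of_ne (by linarith) fun e => ?_
      have := N.fst_inj _ F.hl _ hq e
      rw [this] at hq2; exact lt_irrefl _ hq2
    refine C.advances_of_east F hq (by linarith) hq1 hlq hd0 hE hhS
      ⟨⟨hq1.le, by linarith⟩, ⟨hq2.le, by linarith⟩, Or.inr (Or.inl heq)⟩ hlS heq ?_
    rw [abs_sub_comm l.2, abs_of_pos (by linarith : 0 < q.2 - l.2)]
    rcases abs_cases (h.2 - q.2) with ⟨h', _⟩ | ⟨h', _⟩ <;> rw [h'] <;> linarith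
  · have hq2' : q.2 = l.2 + d := by
      rcases hdc with h' | h' <;> linarith
    have ha1 := F.a_lt_h
    have ha2 := F.a_below
    have hr := F.r_le
    right
    refine ⟨q, l, ⟨h.1 + d, r + ((q.1 - h.1) + (q.2 - h.2)), s, ?_⟩, by linarith⟩
    constructor
    case hh => exact hq
    case hl => exact F.hl
    case empty => exact hE.mono (by linarith) le_rfl le_rfl (by linarith)
    case path_h =>
      refine N.trans _ _ _ _ _ F.path_h (N.edge_le F.hh hq hd0 hhS
        ⟨⟨hq1.le, by linarith⟩, ⟨hq2.le, by linarith⟩, Or.inr (Or.inr (Or.inr hq2'))⟩ hE ?_)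
      rw [abs_sub_comm, abs_of_pos (by linarith : 0 < q.1 - h.1), abs_sub_comm,
        abs_of_nonneg (by linarith : 0 ≤ q.2 - h.2)]
    case path_l => exact F.path_l
    case a_lt_l => exact F.a_lt_l
    case l_lt_b => exact F.l_lt_b
    case a_above => exact F.a_above
    case s_le => exact F.s_le
    all_goals linarith

/-- The square slides to the right between the heights of l and h until its right side meets a point
p; b is a candidate. This works as long as h and l stay on its top and bottom sides; otherwise the
left one of the two obstructs it. -/
lemma advances {a b h l : ℝ × ℝ} {e r s : ℝ} (C : Corridor P D a b)
    (F : Front P D a b h l e r s) : Advances P D a b (h.1 + l.1) := by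
  have N := C.net
  obtain ⟨p, ⟨hp, hp1, hp2, hp3⟩, hpmin⟩ := Set.exists_min_image
    {q | q ∈ P ∧ l.2 < q.2 ∧ q.2 < h.2 ∧ e ≤ q.1} Prod.fst
    (N.finite.subset fun x hx => hx.1) ⟨b, C.hb, F.b_above, F.b_below, F.e_le⟩
  have hpb : p.1 ≤ b.1 := hpmin b ⟨C.hb, F.b_above, F.b_below, F.e_le⟩
  have hmin : ∀ q ∈ P, l.2 < q.2 → q.2 < h.2 → e ≤ q.1 → p.1 ≤ q.1 :=
    fun q hq h1 h2 h3 => hpmin q ⟨hq, h1, h2, h3⟩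
  by_cases hfar : p.1 ≤ h.1 + (h.2 - l.2) ∧ p.1 ≤ l.1 + (h.2 - l.2)
  · have hhe := F.h_le
    have hle := F.l_le
    have hpot := F.potential
    have hhp : h.1 < p.1 := lt_of_le_of_ne (by linarith) fun e => by
      rw [N.fst_inj _ F.hh _ hp e] at hp2; exact lt_irrefl _ hp2
    have hlp : l.1 < p.1 := lt_of_le_of_ne (by linarith) fun e => by
      rw [N.fst_inj _ F.hl _ hp e] at hp1; exact lt_irrefl _ hp1
    refine C.advances_of_east F hp hpb hhp hlp (w := p.1 - (h.2 - l.2)) (t := l.2)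
      (d := h.2 - l.2) (by linarith) ?_ ⟨⟨by linarith, by linarith⟩, ⟨by linarith, by linarith⟩,
        Or.inr (Or.inr (Or.inr (by ring)))⟩ ⟨⟨by linarith, by linarith⟩,
        ⟨by linarith, by linarith⟩, Or.inr (Or.inl (by ring))⟩ ⟨⟨by linarith, by linarith⟩,
        ⟨by linarith, by linarith⟩, Or.inr (Or.inr (Or.inl rfl))⟩ (by ring) ?_
    · intro x hx x1 x2 x3 x4
      rcases lt_or_ge x.1 e with hxe | hxe
      · exact F.empty x hx (by linarith) hxe x3 (by linarith)
      · linarith [hmin x hx x3 (by linarith) hxe]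
    · rw [abs_of_pos (by linarith : 0 < h.2 - p.2), abs_sub_comm l.2,
        abs_of_pos (by linarith : 0 < p.2 - l.2)]
      linarith
  · rcases le_total h.1 l.1 with hhl | hhl
    · refine C.advances_of_far F hhl ?_ hpb hmin
      by_contra hcon
      exact hfar ⟨by linarith, by linarith⟩
    · rw [add_comm]
      refine Advances.of_flip ?_
      refine C.flip.advances_of_far (h := SquareDelaunay.flip l) (l := SquareDelaunay.flip h)
        (p := SquareDelaunay.flip p) F.flip hhl ?_ hpb ?_
      · simp only [flip_fst, flip_snd]
        by_contra hcon
        exact hfar ⟨by linarith, by linarith⟩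
      · intro q hq h1 h2 h3
        simp only [flip_snd] at h1 h2
        exact hmin (SquareDelaunay.flip q) hq (by simp only [flip_snd]; linarith)
          (by simp only [flip_snd]; linarith) h3

lemma of_front {a b h l : ℝ × ℝ} {e r s : ℝ} (C : Corridor P D a b)
    (F : Front P D a b h l e r s) : D a b (corridorBound a b) := by
  refine of_ascent (T := {x : (ℝ × ℝ) × (ℝ × ℝ) | ∃ e r s, Front P D a b x.1 x.2 e r s})
    ((C.net.finite.prod C.net.finite).subset ?_) ⟨(h, l), e, r, s, F⟩
    (fun x => x.1.1 + x.2.1) ?_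
  · rintro x ⟨e, r, s, F⟩
    exact ⟨F.hh, F.hl⟩
  · rintro x ⟨e, r, s, F⟩
    rcases C.advances F with h | ⟨h', l', hF, hlt⟩
    · exact Or.inl h
    · exact Or.inr ⟨(h', l'), hF, hlt⟩

/-! ### Starting the sweep at a -/

lemma l1_le_corridorBound {a b : ℝ × ℝ} (C : Corridor P D a b) :
    |a.1 - b.1| + |a.2 - b.2| ≤ corridorBound a b := by
  have hsq : 0 ≤ √2 := Real.sqrt_nonneg 2
  have := C.lt
  rw [corridorBound, abs_sub_comm a.1, abs_sub_comm a.2, abs_of_pos (by linarith : 0 < b.1 - a.1)]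
  nlinarith

/-- The points `h` above and `l` below the corridor, the latter on the right side of a square that
has `a` on its left side. -/
lemma of_start {a b h l : ℝ × ℝ} (C : Corridor P D a b) (hh : h ∈ P) (hl : l ∈ P)
    (hah : a.1 < h.1) (hal : a.1 < l.1) (hlb : l.1 < b.1) (hhl : h.1 ≤ l.1)
    (h2 : a.2 < h.2 ∧ b.2 < h.2) (l2 : l.2 < a.2 ∧ l.2 < b.2) (hH : h.2 - l.2 ≤ l.1 - a.1)
    (hE : EmptyBox P a.1 l.1 (h.2 - (l.1 - a.1)) h.2) :
    D a b (corridorBound a b) := by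
  have N := C.net
  obtain ⟨h2, h2'⟩ := h2
  obtain ⟨l2, l2'⟩ := l2
  have hE' : EmptyBox P a.1 (a.1 + (l.1 - a.1)) (h.2 - (l.1 - a.1))
      (h.2 - (l.1 - a.1) + (l.1 - a.1)) :=
    hE.mono le_rfl (by linarith) le_rfl (by linarith)
  have hd : 0 < l.1 - a.1 := by linarith
  have aS : OnSquare a.1 (h.2 - (l.1 - a.1)) (l.1 - a.1) a :=
    ⟨⟨le_rfl, by linarith⟩, ⟨by linarith, by linarith⟩, Or.inl rfl⟩
  have hS : OnSquare a.1 (h.2 - (l.1 - a.1)) (l.1 - a.1) h :=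
    ⟨⟨hah.le, by linarith⟩, ⟨by linarith, by linarith⟩, Or.inr (Or.inr (Or.inr (by ring)))⟩
  have lS : OnSquare a.1 (h.2 - (l.1 - a.1)) (l.1 - a.1) l :=
    ⟨⟨hal.le, by linarith⟩, ⟨by linarith, by linarith⟩, Or.inr (Or.inl (by ring))⟩
  have Dh : D a h ((h.1 - a.1) + (h.2 - a.2)) := N.edge_le C.ha hh hd aS hS hE' (by
    rw [abs_sub_comm, abs_of_pos (by linarith : 0 < h.1 - a.1), abs_sub_comm,
      abs_of_pos (by linarith : 0 < h.2 - a.2)])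
  have Dl : D a l ((l.1 - a.1) + (a.2 - l.2)) := N.edge_le C.ha hl hd aS lS hE' (by
    rw [abs_sub_comm, abs_of_pos (by linarith : 0 < l.1 - a.1),
      abs_of_pos (by linarith : 0 < a.2 - l.2)])
  rcases le_or_gt (l.1 - (h.2 - l.2)) h.1 with hle | hlt
  · refine C.of_front (h := h) (l := l) (e := l.1) (r := (h.1 - a.1) + (h.2 - a.2))
      (s := (l.1 - a.1) + (a.2 - l.2)) ?_
    constructor
    case hh => exact hh
    case hl => exact hl
    case empty => exact hE.mono (by linarith) le_rfl (by linarith) le_rfl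
    case path_h => exact Dh
    case path_l => exact Dl
    all_goals linarith
  · have := C.flip.of_gentle (h := SquareDelaunay.flip l) (l := SquareDelaunay.flip h)
      (r := (h.1 - a.1) + (h.2 - a.2))
      (by simpa using hl) hah hlb (by simpa using l2') (by simpa using h2')
      (by simp only [flip_fst, flip_snd]; linarith)
      (hE.flip.mono hah.le le_rfl le_rfl (by simp only [flip_snd]; linarith))
      (by simp only [flip_fst, flip_snd]; linarith) (by simpa using Dh)
      (C.flip.net.edge_inf _ (by simpa using hh) _ (by simpa using hl) _ _ _ hd hS.flip lS.flip
        (hE'.flip.mono le_rfl le_rfl (by linarith) (by linarith)))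
    simpa only [corridorBound_flip, flip_flip] using this

/-- `key` is the least side of a square that has its left side on the vertical line through a and
contains both points. A minimal pair yields an empty square through a, h and l. If no key is below
b.1 - a.1, then a and b lie on opposite sides of an empty square. -/
lemma path {a b : ℝ × ℝ} (C : Corridor P D a b) : D a b (corridorBound a b) := by
  have N := C.net
  have hab := C.lt
  let T : Set ((ℝ × ℝ) × (ℝ × ℝ)) := {x | x.1 ∈ P ∧ x.2 ∈ P ∧ (a.1 < x.1.1 ∧ x.1.1 < b.1) ∧
    (a.1 < x.2.1 ∧ x.2.1 < b.1) ∧ (a.2 < x.1.2 ∧ b.2 < x.1.2) ∧ (x.2.2 < a.2 ∧ x.2.2 < b.2)}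
  let key : (ℝ × ℝ) × (ℝ × ℝ) → ℝ :=
    fun x => max (max (x.1.1 - a.1) (x.2.1 - a.1)) (x.1.2 - x.2.2)
  have hTf : T.Finite := (N.finite.prod N.finite).subset fun x hx => ⟨hx.1, hx.2.1⟩
  by_cases hex : ∃ x ∈ T, key x < b.1 - a.1
  · obtain ⟨x₀, hx₀, hk₀⟩ := hex
    obtain ⟨x₁, hx₁, hmin₁⟩ := Set.exists_min_image T key hTf ⟨x₀, hx₀⟩
    -- Minimising the vertical gap among the key-minimal pairs excludes points of the strip between
    -- the heights of h and l (`habove`, `hbelow`).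
    obtain ⟨⟨h, l⟩, ⟨hx, hkx⟩, hmin⟩ := Set.exists_min_image {x | x ∈ T ∧ key x ≤ key x₁}
      (fun x => x.1.2 - x.2.2) (hTf.subset fun x hx => hx.1) ⟨x₁, hx₁, le_rfl⟩
    have hkey : ∀ y ∈ T, key (h, l) ≤ key y := fun y hy => hkx.trans (hmin₁ y hy)
    have hkb : key (h, l) < b.1 - a.1 := (hkey x₀ hx₀).trans_lt hk₀
    have hH : ∀ y ∈ T, key y ≤ key (h, l) → h.2 - l.2 ≤ y.1.2 - y.2.2 :=
      fun y hy hyk => hmin y ⟨hy, hyk.trans hkx⟩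
    clear hmin hkx hmin₁ hx₁ hk₀ hx₀
    obtain ⟨hh, hl, ⟨hah, hhb⟩, ⟨hal, hlb⟩, ⟨h2, h2'⟩, ⟨l2, l2'⟩⟩ := hx
    dsimp only at hh hl hah hhb hal hlb h2 h2' l2 l2'
    have k1 : h.1 - a.1 ≤ key (h, l) := (le_max_left _ _).trans (le_max_left _ _)
    have k2 : l.1 - a.1 ≤ key (h, l) := (le_max_right _ _).trans (le_max_left _ _)
    have k3 : h.2 - l.2 ≤ key (h, l) := le_max_right _ _
    have kc : key (h, l) = h.1 - a.1 ∨ key (h, l) = l.1 - a.1 ∨ key (h, l) = h.2 - l.2 := by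
      rcases max_choice (max (h.1 - a.1) (l.1 - a.1)) (h.2 - l.2) with h' | h'
      · rcases max_choice (h.1 - a.1) (l.1 - a.1) with h'' | h''
        · exact Or.inl (h'.trans h'')
        · exact Or.inr (Or.inl (h'.trans h''))
      · exact Or.inr (Or.inr h')
    have habove : ∀ q ∈ P, a.1 < q.1 → q.1 ≤ a.1 + key (h, l) → a.2 < q.2 ∧ b.2 < q.2 →
        h.2 ≤ q.2 := by
      intro q hq q1 q2 q3
      by_contra hlt
      push Not at hlt
      have := hH (q, l) ⟨hq, hl, ⟨q1, by linarith⟩, ⟨hal, hlb⟩, q3, l2, l2'⟩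
        (max_le (max_le (by simp only; linarith) k2) (by simp only; linarith))
      simp only at this
      linarith
    have hbelow : ∀ q ∈ P, a.1 < q.1 → q.1 ≤ a.1 + key (h, l) → q.2 < a.2 ∧ q.2 < b.2 →
        q.2 ≤ l.2 := by
      intro q hq q1 q2 q3
      by_contra hlt
      push Not at hlt
      have := hH (h, q) ⟨hh, hq, ⟨hah, hhb⟩, ⟨q1, by linarith⟩, ⟨h2, h2'⟩, q3⟩
        (max_le (max_le k1 (by simp only; linarith)) (by simp only; linarith))
      simp only at this
      linarith
    -- The minimal square has h on its right side, or l on its right side, or h and l on its top and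
    -- bottom.
    rcases kc with hk | hk | hk
    · have := C.flip.of_start (h := SquareDelaunay.flip l) (l := SquareDelaunay.flip h)
        (by simpa using hl) (by simpa using hh) hal hah hhb
        (by simp only [flip_fst]; linarith)
        ⟨by simpa using l2, by simpa using l2'⟩ ⟨by simpa using h2, by simpa using h2'⟩
        (by simp only [flip_fst, flip_snd]; linarith) ?_
      · simpa only [corridorBound_flip, flip_flip] using this
      · intro q hq q1 q2 q3 q4
        simp only [flip_fst, flip_snd] at q1 q2 q3 q4
        rcases C.sides _ hq q1 (by simp only [flip_fst]; linarith) with hs | hs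
        · have hc := hkey (SquareDelaunay.flip q, l)
            ⟨hq, hl, ⟨q1, by simp only [flip_fst]; linarith⟩, ⟨hal, hlb⟩, hs, l2, l2'⟩
          have hlt : l.1 < h.1 := lt_of_le_of_ne (by linarith) fun e => by
            rw [N.fst_inj _ hl _ hh e] at l2; linarith
          exact absurd hc (not_le.mpr (max_lt (max_lt (by simp only [flip_fst]; linarith)
            (by simp only; linarith)) (by simp only [flip_snd]; linarith)))
        · have := hbelow _ hq q1 (by simp only [flip_fst]; linarith) hs
          simp only [flip_snd] at this
          linarith
    · refine C.of_start hh hl hah hal hlb (by linarith) ⟨h2, h2'⟩ ⟨l2, l2'⟩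
        (by linarith) ?_
      intro q hq q1 q2 q3 q4
      rcases C.sides _ hq q1 (by linarith) with hs | hs
      · linarith [habove q hq q1 (by linarith) hs]
      · have hc := hkey (h, q) ⟨hh, hq, ⟨hah, hhb⟩, ⟨q1, by simp only; linarith⟩, ⟨h2, h2'⟩, hs⟩
        have hlt : h.1 < l.1 := lt_of_le_of_ne (by linarith) fun e => by
          rw [N.fst_inj _ hh _ hl e] at h2; linarith
        exact absurd hc (not_le.mpr (max_lt (max_lt (by simp only; linarith)
          (by simp only; linarith)) (by simp only; linarith)))
    · have hE : EmptyBox P a.1 (a.1 + (h.2 - l.2)) l.2 h.2 := by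
        intro q hq q1 q2 q3 q4
        rcases C.sides _ hq q1 (by linarith) with hs | hs
        · linarith [habove q hq q1 (by linarith) hs]
        · linarith [hbelow q hq q1 (by linarith) hs]
      have hE' : EmptyBox P a.1 (a.1 + (h.2 - l.2)) l.2 (l.2 + (h.2 - l.2)) :=
        hE.mono le_rfl le_rfl le_rfl (by linarith)
      have hd : 0 < h.2 - l.2 := by linarith
      have aS : OnSquare a.1 l.2 (h.2 - l.2) a :=
        ⟨⟨le_rfl, by linarith⟩, ⟨by linarith, by linarith⟩, Or.inl rfl⟩
      refine C.of_front (h := h) (l := l) (e := a.1 + (h.2 - l.2))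
        (r := (h.1 - a.1) + (h.2 - a.2)) (s := (l.1 - a.1) + (a.2 - l.2)) ?_
      constructor
      case hh => exact hh
      case hl => exact hl
      case empty => exact hE.mono (by linarith) le_rfl le_rfl le_rfl
      case path_h =>
        refine N.edge_le C.ha hh hd aS ⟨⟨hah.le, by linarith⟩, ⟨by linarith, by linarith⟩,
          Or.inr (Or.inr (Or.inr (by ring)))⟩ hE' ?_
        rw [abs_sub_comm, abs_of_pos (by linarith : 0 < h.1 - a.1), abs_sub_comm,
          abs_of_pos (by linarith : 0 < h.2 - a.2)]
      case path_l =>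
        refine N.edge_le C.ha hl hd aS ⟨⟨hal.le, by linarith⟩, ⟨le_rfl, by linarith⟩,
          Or.inr (Or.inr (Or.inl rfl))⟩ hE' ?_
        rw [abs_sub_comm, abs_of_pos (by linarith : 0 < l.1 - a.1),
          abs_of_pos (by linarith : 0 < a.2 - l.2)]
      all_goals linarith
  · push Not at hex
    have hup := C.up
    have hdown := C.down
    suffices h : ∃ t, t ≤ a.2 ∧ t ≤ b.2 ∧ a.2 ≤ t + (b.1 - a.1) ∧ b.2 ≤ t + (b.1 - a.1) ∧
        EmptyBox P a.1 b.1 t (t + (b.1 - a.1)) by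
      obtain ⟨t, t1, t2, t3, t4, hE⟩ := h
      exact N.edge_le C.ha C.hb (by linarith) ⟨⟨le_rfl, by linarith⟩, ⟨t1, t3⟩, Or.inl rfl⟩
        ⟨⟨by linarith, by linarith⟩, ⟨t2, t4⟩, Or.inr (Or.inl (by ring))⟩
        (hE.mono le_rfl (by linarith) le_rfl le_rfl) C.l1_le_corridorBound
    have hm1 := min_le_left a.2 b.2
    have hm2 := min_le_right a.2 b.2
    have hmc := min_choice a.2 b.2
    set m := min a.2 b.2
    have hma : a.2 ≤ m + (b.1 - a.1) := by rcases hmc with h | h <;> linarith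
    have hmb : b.2 ≤ m + (b.1 - a.1) := by rcases hmc with h | h <;> linarith
    by_cases hU : ∃ q ∈ P, a.1 < q.1 ∧ q.1 < b.1 ∧ a.2 < q.2 ∧ b.2 < q.2
    · obtain ⟨h, ⟨hh, h1, h1', h2, h2'⟩, hmin⟩ := Set.exists_min_image
        {q | q ∈ P ∧ a.1 < q.1 ∧ q.1 < b.1 ∧ a.2 < q.2 ∧ b.2 < q.2} Prod.snd
        (N.finite.subset fun x hx => hx.1) hU
      have n1 := min_le_left m (h.2 - (b.1 - a.1))
      have n2 := min_le_right m (h.2 - (b.1 - a.1))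
      have nc := min_choice m (h.2 - (b.1 - a.1))
      -- The square is lowered until its top is no higher than the lowest upper point; by `hex`
      -- every lower point is at least b.1 - a.1 below that.
      refine ⟨min m (h.2 - (b.1 - a.1)), by linarith, by linarith, ?_, ?_, ?_⟩
      · rcases nc with h | h <;> linarith
      · rcases nc with h | h <;> linarith
      · intro q hq q1 q2 q3 q4
        rcases C.sides q hq q1 q2 with hs | hs
        · have := hmin q ⟨hq, q1, q2, hs⟩
          linarith
        · have hk := hex (h, q) ⟨hh, hq, ⟨h1, h1'⟩, ⟨q1, q2⟩, ⟨h2, h2'⟩, hs⟩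
          have : b.1 - a.1 ≤ h.2 - q.2 := by
            by_contra hlt
            push Not at hlt
            exact absurd hk (not_le.mpr (max_lt (max_lt (by simp only; linarith)
              (by simp only; linarith)) hlt))
          rcases nc with h | h
          · rcases hmc with h' | h' <;> linarith
          · linarith
    · refine ⟨m, hm1, hm2, hma, hmb, ?_⟩
      intro q hq q1 q2 q3 q4
      rcases C.sides q hq q1 q2 with hs | hs
      · exact hU ⟨q, hq, q1, q2, hs⟩
      · rcases hmc with h' | h' <;> linarith

end Corridor

/-! ### Induction on the L∞-distance -/

lemma bound_eq_corridorBound {a b : ℝ × ℝ} (h : a.1 < b.1) (h' : |b.2 - a.2| ≤ b.1 - a.1) :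
    bound a b = corridorBound a b := by
  rw [bound, corridorBound, abs_sub_comm a.1, abs_sub_comm a.2,
    abs_of_pos (by linarith : 0 < b.1 - a.1), max_eq_left h']
  ring

lemma bound_of_le {a b : ℝ × ℝ} (h : a.1 ≤ b.1) (h' : a.2 ≤ b.2) :
    bound a b = (b.1 - a.1) + (b.2 - a.2) + √2 * max (b.1 - a.1) (b.2 - a.2) := by
  rw [bound, abs_sub_comm a.1, abs_sub_comm a.2, abs_of_nonneg (by linarith : 0 ≤ b.1 - a.1),
    abs_of_nonneg (by linarith : 0 ≤ b.2 - a.2)]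

lemma bound_comm (a b : ℝ × ℝ) : bound a b = bound b a := by
  rw [bound, bound, abs_sub_comm a.1, abs_sub_comm a.2]

lemma bound_swap (a b : ℝ × ℝ) : bound a.swap b.swap = bound a b := by
  rw [bound, bound, add_comm |a.1 - b.1|, max_comm |a.1 - b.1|]; rfl

namespace Net

/-- If the rectangle spanned by `a` and `b` contains a third point, then a path is composed of two
shorter ones. -/
lemma path_of_mem {a b c : ℝ × ℝ} (N : Net P D) (ha : a ∈ P) (hb : b ∈ P) (hc : c ∈ P)
    (hab : b.2 - a.2 ≤ b.1 - a.1) (ac1 : a.1 < c.1) (cb1 : c.1 < b.1) (ac2 : a.2 < c.2)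
    (cb2 : c.2 < b.2) (ih : BoundBelow P D (b.1 - a.1)) : D a b (bound a b) := by
  have hsq : 0 ≤ √2 := Real.sqrt_nonneg 2
  have hB : bound a b = (b.1 - a.1) + (b.2 - a.2) + √2 * (b.1 - a.1) := by
    rw [bound_of_le (by linarith) (by linarith), max_eq_left hab]
  have rec_le : ∀ u ∈ P, ∀ v ∈ P, u.1 < v.1 → u.2 < v.2 → v.1 - u.1 < b.1 - a.1 →
      v.2 - u.2 < b.1 - a.1 → D u v (bound u v) := by
    intro u hu v hv h1 h2 h3 h4
    refine ih u hu v hv ?_ ?_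
    · rwa [abs_sub_comm, abs_of_pos (by linarith)]
    · rwa [abs_sub_comm, abs_of_pos (by linarith)]
  -- With c horizontally close to a, the square growing from its corner a meets a point q while its
  -- side is at most b.2 - a.2, hence within the rectangle; the L1-length of aq is additive with the
  -- bound for q and b. The case of c close to b is symmetric.
  by_cases hca : c.1 - a.1 ≤ b.2 - a.2
  · obtain ⟨q, ⟨hq, q1, q2⟩, hmin⟩ := Set.exists_min_image
      {q | q ∈ P ∧ a.1 < q.1 ∧ a.2 < q.2} (fun q => max (q.1 - a.1) (q.2 - a.2))
      (N.finite.subset fun x hx => hx.1) ⟨c, hc, ac1, ac2⟩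
    have hqc : max (q.1 - a.1) (q.2 - a.2) ≤ b.2 - a.2 :=
      (hmin c ⟨hc, ac1, ac2⟩).trans (max_le (by linarith) (by linarith))
    have m1 := le_max_left (q.1 - a.1) (q.2 - a.2)
    have m2 := le_max_right (q.1 - a.1) (q.2 - a.2)
    have mc := max_choice (q.1 - a.1) (q.2 - a.2)
    set d := max (q.1 - a.1) (q.2 - a.2)
    have hE : EmptyBox P a.1 (a.1 + d) a.2 (a.2 + d) := fun x hx x1 x2 x3 x4 =>
      absurd (hmin x ⟨hx, x1, x3⟩) (not_le.mpr (max_lt (by linarith) (by linarith)))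
    have hD : D a q ((q.1 - a.1) + (q.2 - a.2)) := by
      refine N.edge_le ha hq (by linarith) ⟨⟨le_rfl, by linarith⟩, ⟨le_rfl, by linarith⟩,
        Or.inl rfl⟩ ⟨⟨q1.le, by linarith⟩, ⟨q2.le, by linarith⟩, ?_⟩ hE ?_
      · rcases mc with h | h
        · exact Or.inr (Or.inl (by linarith))
        · exact Or.inr (Or.inr (Or.inr (by linarith)))
      · rw [abs_sub_comm, abs_of_pos (by linarith : 0 < q.1 - a.1), abs_sub_comm,
          abs_of_pos (by linarith : 0 < q.2 - a.2)]
    rcases eq_or_ne q b with rfl | hqb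
    · exact N.mono _ _ _ _ hD (by rw [hB]; nlinarith)
    have qb1 : q.1 < b.1 := lt_of_le_of_ne (by linarith) fun e => hqb (N.fst_inj _ hq _ hb e)
    have qb2 : q.2 < b.2 := lt_of_le_of_ne (by linarith) fun e => hqb (N.snd_inj _ hq _ hb e)
    have hD' := rec_le q hq b hb qb1 qb2 (by linarith) (by linarith)
    refine N.mono _ _ _ _ (N.trans _ _ _ _ _ hD hD') ?_
    rw [hB, bound_of_le qb1.le qb2.le]
    have : max (b.1 - q.1) (b.2 - q.2) ≤ b.1 - a.1 := max_le (by linarith) (by linarith)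
    have := mul_le_mul_of_nonneg_left this hsq
    linarith
  by_cases hcb : b.1 - c.1 ≤ b.2 - a.2
  · obtain ⟨q, ⟨hq, q1, q2⟩, hmin⟩ := Set.exists_min_image
      {q | q ∈ P ∧ q.1 < b.1 ∧ q.2 < b.2} (fun q => max (b.1 - q.1) (b.2 - q.2))
      (N.finite.subset fun x hx => hx.1) ⟨c, hc, cb1, cb2⟩
    have hqc : max (b.1 - q.1) (b.2 - q.2) ≤ b.2 - a.2 :=
      (hmin c ⟨hc, cb1, cb2⟩).trans (max_le (by linarith) (by linarith))
    have m1 := le_max_left (b.1 - q.1) (b.2 - q.2)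
    have m2 := le_max_right (b.1 - q.1) (b.2 - q.2)
    have mc := max_choice (b.1 - q.1) (b.2 - q.2)
    set d := max (b.1 - q.1) (b.2 - q.2)
    have hE : EmptyBox P (b.1 - d) (b.1 - d + d) (b.2 - d) (b.2 - d + d) :=
      fun x hx x1 x2 x3 x4 => absurd (hmin x ⟨hx, by linarith, by linarith⟩)
        (not_le.mpr (max_lt (by linarith) (by linarith)))
    have hD : D q b ((b.1 - q.1) + (b.2 - q.2)) := by
      refine N.edge_le hq hb (by linarith) ⟨⟨by linarith, by linarith⟩,
        ⟨by linarith, by linarith⟩, ?_⟩ ⟨⟨by linarith, by linarith⟩,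
        ⟨by linarith, by linarith⟩, Or.inr (Or.inl (by ring))⟩ hE ?_
      · rcases mc with h | h
        · exact Or.inl (by linarith)
        · exact Or.inr (Or.inr (Or.inl (by linarith)))
      · rw [abs_sub_comm, abs_of_pos (by linarith : 0 < b.1 - q.1), abs_sub_comm,
          abs_of_pos (by linarith : 0 < b.2 - q.2)]
    rcases eq_or_ne q a with rfl | hqa
    · exact N.mono _ _ _ _ hD (by rw [hB]; nlinarith)
    have aq1 : a.1 < q.1 := lt_of_le_of_ne (by linarith) fun e => hqa (N.fst_inj _ hq _ ha e.symm)
    have aq2 : a.2 < q.2 := lt_of_le_of_ne (by linarith) fun e => hqa (N.snd_inj _ hq _ ha e.symm)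
    have hD' := rec_le a ha q hq aq1 aq2 (by linarith) (by linarith)
    refine N.mono _ _ _ _ (N.trans _ _ _ _ _ hD' hD) ?_
    rw [hB, bound_of_le aq1.le aq2.le]
    have : max (q.1 - a.1) (q.2 - a.2) ≤ b.1 - a.1 := max_le (by linarith) (by linarith)
    have := mul_le_mul_of_nonneg_left this hsq
    linarith
  -- Both partial rectangles are now wider than high, so their bounds add up exactly.
  · have h1 := rec_le a ha c hc ac1 ac2 (by linarith) (by linarith)
    have h2 := rec_le c hc b hb cb1 cb2 (by linarith) (by linarith)
    refine N.mono _ _ _ _ (N.trans _ _ _ _ _ h1 h2) ?_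
    rw [hB, bound_of_le ac1.le ac2.le, bound_of_le cb1.le cb2.le, max_eq_left (by linarith),
      max_eq_left (by linarith)]
    linarith

lemma path_of_gentle {a b : ℝ × ℝ} (N : Net P D) (ha : a ∈ P) (hb : b ∈ P) (hab : a.1 < b.1)
    (hab' : |b.2 - a.2| ≤ b.1 - a.1) (ih : BoundBelow P D (b.1 - a.1)) : D a b (bound a b) := by
  obtain ⟨hd, hu⟩ := abs_le.mp hab'
  by_cases hR : ∃ c ∈ P, a.1 < c.1 ∧ c.1 < b.1 ∧
      ((a.2 < c.2 ∧ c.2 < b.2) ∨ (b.2 < c.2 ∧ c.2 < a.2))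
  · obtain ⟨c, hc, h1, h2, h3 | h3⟩ := hR
    · exact N.path_of_mem ha hb hc hu h1 h2 h3.1 h3.2 ih
    · have := N.flip.path_of_mem (a := SquareDelaunay.flip a) (b := SquareDelaunay.flip b)
        (c := SquareDelaunay.flip c) (by simpa using ha) (by simpa using hb) (by simpa using hc)
        (by simp only [flip_fst, flip_snd]; linarith) h1 h2 (by simpa using h3.2)
        (by simpa using h3.1) ih.flip
      simpa only [bound_flip, flip_flip] using this
  · rw [bound_eq_corridorBound hab hab']
    refine Corridor.path ⟨N, ha, hb, hab, hu, by linarith, ?_, ih⟩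
    intro q hq q1 q2
    have n1 : q.2 ≠ a.2 := fun e => by rw [N.snd_inj _ hq _ ha e] at q1; exact lt_irrefl _ q1
    have n2 : q.2 ≠ b.2 := fun e => by rw [N.snd_inj _ hq _ hb e] at q2; exact lt_irrefl _ q2
    by_contra hcon
    refine hR ⟨q, hq, q1, q2, ?_⟩
    rcases lt_or_gt_of_ne n1 with n1 | n1 <;> rcases lt_or_gt_of_ne n2 with n2 | n2 <;> tauto

lemma path_of_abs_le {a b : ℝ × ℝ} (N : Net P D) (ha : a ∈ P) (hb : b ∈ P) (hab : a.1 ≠ b.1)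
    (hab' : |a.2 - b.2| ≤ |a.1 - b.1|) (ih : BoundBelow P D |a.1 - b.1|) :
    D a b (bound a b) := by
  rcases lt_or_gt_of_ne hab with hlt | hlt
  · rw [abs_sub_comm, abs_sub_comm a.1, abs_of_pos (by linarith : 0 < b.1 - a.1)] at hab'
    rw [abs_sub_comm, abs_of_pos (by linarith : 0 < b.1 - a.1)] at ih
    exact N.path_of_gentle ha hb hlt hab' ih
  · rw [abs_of_pos (by linarith : 0 < a.1 - b.1)] at hab' ih
    rw [bound_comm]
    exact N.symm _ _ _ (N.path_of_gentle hb ha hlt hab' ih)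

/-- A counterexample of least L∞-distance supplies the induction hypothesis; exchanging the axes
makes it at least as wide as high. -/
theorem path (N : Net P D) {a b : ℝ × ℝ} (ha : a ∈ P) (hb : b ∈ P) : D a b (bound a b) := by
  by_contra hcon
  obtain ⟨⟨u, v⟩, ⟨hu, hv, hbad⟩, hmin⟩ := Set.exists_min_image
    {x : (ℝ × ℝ) × (ℝ × ℝ) | x.1 ∈ P ∧ x.2 ∈ P ∧ ¬ D x.1 x.2 (bound x.1 x.2)}
    (fun x => max |x.1.1 - x.2.1| |x.1.2 - x.2.2|)
    ((N.finite.prod N.finite).subset fun x hx => ⟨hx.1, hx.2.1⟩) ⟨(a, b), ha, hb, hcon⟩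
  dsimp only at hu hv hbad
  have ih : BoundBelow P D (max |u.1 - v.1| |u.2 - v.2|) := by
    intro c hc d hd h1 h2
    by_contra hcd
    exact absurd (hmin (c, d) ⟨hc, hd, hcd⟩) (not_le.mpr (max_lt h1 h2))
  apply hbad
  rcases eq_or_ne u v with rfl | hne
  · simpa [bound] using N.refl u hu
  rcases le_total |u.2 - v.2| |u.1 - v.1| with h | h
  · rw [max_eq_left h] at ih
    exact N.path_of_abs_le hu hv (fun e => hne (N.fst_inj _ hu _ hv e)) h ih
  · rw [max_eq_right h] at ih
    have := N.swap.path_of_abs_le (a := u.swap) (b := v.swap) (by simpa using hu)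
      (by simpa using hv) (fun e => hne (N.snd_inj _ hu _ hv e)) h ih.swap
    rw [bound_swap] at this
    simpa using this

end Net

lemma bound_le (u v : ℝ × ℝ) :
    bound u v ≤ √(4 + 2 * √2) * √((u.1 - v.1) ^ 2 + (u.2 - v.2) ^ 2) := by
  have key : ∀ x y : ℝ, 0 ≤ x → 0 ≤ y → x + y + √2 * x ≤ √(4 + 2 * √2) * √(x ^ 2 + y ^ 2) := by
    intro x y hx hy
    rw [← Real.sqrt_mul (by positivity)]
    apply Real.le_sqrt_of_sq_le
    have h2 : √2 ^ 2 = 2 := Real.sq_sqrt (by norm_num)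
    -- As 4 + 2√2 = (1 + √2)² + 1, this square is the defect in Cauchy–Schwarz.
    nlinarith [sq_nonneg (x - (1 + √2) * y)]
  rw [bound, ← sq_abs (u.1 - v.1), ← sq_abs (u.2 - v.2)]
  rcases le_total |u.2 - v.2| |u.1 - v.1| with h | h
  · rw [max_eq_left h]
    exact key _ _ (abs_nonneg _) (abs_nonneg _)
  · rw [max_eq_right h, add_comm |u.1 - v.1|, add_comm (|u.1 - v.1| ^ 2)]
    exact key _ _ (abs_nonneg _) (abs_nonneg _)

/-! ### Walks and the stretch factor -/

section Graph

variable {V : Finset Plane} {G : SimpleGraph V}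

/-- Euclidean length of a walk as a real number. -/
noncomputable def realLength {u v : V} (p : G.Walk u v) : ℝ :=
  (p.darts.map fun e => dist (e.fst : Plane) (e.snd : Plane)).sum

lemma realLength_nonneg {u v : V} (p : G.Walk u v) : 0 ≤ realLength p :=
  List.sum_nonneg fun x hx => by
    obtain ⟨e, -, rfl⟩ := List.mem_map.mp hx
    exact dist_nonneg

lemma realLength_append {u v w : V} (p : G.Walk u v) (q : G.Walk v w) :
    realLength (p.append q) = realLength p + realLength q := by
  simp [realLength, SimpleGraph.Walk.darts_append]

lemma realLength_reverse {u v : V} (p : G.Walk u v) : realLength p.reverse = realLength p := by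
  simp [realLength, SimpleGraph.Walk.darts_reverse, Function.comp_def, dist_comm]

lemma walkLength_eq_ofReal {u v : V} (p : G.Walk u v) :
    walkLength p = ENNReal.ofReal (realLength p) := by
  induction p with
  | nil => simp [walkLength, realLength]
  | cons h p ih =>
    have := realLength_nonneg p
    simp only [walkLength, realLength, SimpleGraph.Walk.darts_cons, List.map_cons,
      List.sum_cons] at ih this ⊢
    rw [ih, ENNReal.ofReal_add dist_nonneg this, edist_dist]

lemma edist_le_walkLength {u v : V} (p : G.Walk u v) :
    edist (u : Plane) (v : Plane) ≤ walkLength p := by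
  induction p with
  | nil => simp
  | cons h p ih =>
    simp only [walkLength, SimpleGraph.Walk.darts_cons, List.map_cons, List.sum_cons] at ih ⊢
    exact (edist_triangle _ _ _).trans (add_le_add le_rfl ih)

/-- By the triangle inequality, distances in the complete graph are at least Euclidean. -/
lemma stretchFactor_le {t : ℝ} (h : ∀ u v : V, ∃ p : G.Walk u v,
    realLength p ≤ t * dist (u : Plane) (v : Plane)) : stretchFactor G ≤ ENNReal.ofReal t := by
  refine sInf_le ⟨le_top, fun u v => ?_⟩
  obtain ⟨p, hp⟩ := h u v
  calc graphDist G u v ≤ walkLength p := iInf_le _ p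
    _ ≤ ENNReal.ofReal (t * dist (u : Plane) (v : Plane)) := by
        rw [walkLength_eq_ofReal]; exact ENNReal.ofReal_le_ofReal hp
    _ = ENNReal.ofReal t * edist (u : Plane) (v : Plane) := by
        rw [ENNReal.ofReal_mul' dist_nonneg, edist_dist]
    _ ≤ ENNReal.ofReal t * graphDist ⊤ u v := by
        gcongr
        exact le_iInf fun p => edist_le_walkLength p

end Graph

/-! ### Delaunay graphs as nets -/

/-- There is a walk of length at most `r` between the points with coordinates `u` and `v`. -/
def HasWalk {V : Finset Plane} (G : SimpleGraph V) (φ : Plane → ℝ × ℝ) (u v : ℝ × ℝ) (r : ℝ) :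
    Prop :=
  ∃ x y : V, φ x = u ∧ φ y = v ∧ ∃ p : G.Walk x y, realLength p ≤ r

/-- The isometry φ carries the squares of `d` to axis-parallel ones, side s corresponding to size
k·s/2. Both edge bounds dominate the Euclidean length. -/
lemma net_delaunay {V : Finset Plane} {d : Plane → Plane → ℝ} {φ : Plane → ℝ × ℝ} {k : ℝ}
    (hk : 0 < k) (hφ : Function.Bijective φ)
    (hdist : ∀ u v, dist u v = √(((φ u).1 - (φ v).1) ^ 2 + ((φ u).2 - (φ v).2) ^ 2))
    (hd : ∀ u v, d u v = k * max |(φ u).1 - (φ v).1| |(φ u).2 - (φ v).2|)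
    (hgp : ∀ u ∈ V, ∀ v ∈ V, u ≠ v → (φ u).1 ≠ (φ v).1 ∧ (φ u).2 ≠ (φ v).2) :
    Net (φ '' V) (HasWalk (delaunay d V) φ) := by
  have edge : ∀ u ∈ φ '' V, ∀ v ∈ φ '' V, ∀ w t s, 0 < s → OnSquare w t s u → OnSquare w t s v →
      EmptyBox (φ '' V) w (w + s) t (t + s) →
      HasWalk (delaunay d V) φ u v (√((u.1 - v.1) ^ 2 + (u.2 - v.2) ^ 2)) := by
    rintro _ ⟨x, hx, rfl⟩ _ ⟨y, hy, rfl⟩ w t s hs hxS hyS hE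
    refine ⟨⟨x, hx⟩, ⟨y, hy⟩, rfl, rfl, ?_⟩
    by_cases hxy : x = y
    · subst hxy
      exact ⟨.nil, by simp [realLength]⟩
    obtain ⟨c, hc⟩ := hφ.2 (w + s / 2, t + s / 2)
    have hbd : ∀ z, OnSquare w t s (φ z) → d z c = k * (s / 2) := by
      rintro z ⟨⟨z1, z2⟩, ⟨z3, z4⟩, z5⟩
      rw [hd, hc]
      congr 1
      apply le_antisymm
      · exact max_le (abs_le.mpr ⟨by linarith, by linarith⟩) (abs_le.mpr ⟨by linarith, by linarith⟩)
      · rcases z5 with z5 | z5 | z5 | z5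
        · exact le_max_of_le_left (le_abs.mpr (Or.inr (by simp only; linarith)))
        · exact le_max_of_le_left (le_abs.mpr (Or.inl (by simp only; linarith)))
        · exact le_max_of_le_right (le_abs.mpr (Or.inr (by simp only; linarith)))
        · exact le_max_of_le_right (le_abs.mpr (Or.inl (by simp only; linarith)))
    have hadj : (delaunay d V).Adj ⟨x, hx⟩ ⟨y, hy⟩ := by
      refine ⟨fun e => hxy (congrArg Subtype.val e), c, k * (s / 2), by positivity, hbd x hxS,
        hbd y hyS, fun z hz hlt => ?_⟩
      change d z c < _ at hlt
      rw [hd, hc] at hlt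
      have := lt_of_mul_lt_mul_left hlt hk.le
      obtain ⟨a1, a2⟩ := max_lt_iff.mp this
      obtain ⟨b1, b2⟩ := abs_lt.mp a1
      obtain ⟨b3, b4⟩ := abs_lt.mp a2
      exact hE _ ⟨z, hz, rfl⟩ (by linarith) (by linarith) (by linarith) (by linarith)
    refine ⟨hadj.toWalk, ?_⟩
    rw [← hdist]
    simp [realLength]
  have hmono : ∀ u v r s, HasWalk (delaunay d V) φ u v r → r ≤ s →
      HasWalk (delaunay d V) φ u v s := by
    rintro u v r s ⟨x, y, hx, hy, p, hp⟩ hrs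
    exact ⟨x, y, hx, hy, p, hp.trans hrs⟩
  refine ⟨V.finite_toSet.image φ, ?_, ?_, ?_, hmono, ?_, ?_, ?_, ?_⟩
  · rintro _ ⟨x, hx, rfl⟩ _ ⟨y, hy, rfl⟩ h
    by_contra hne
    exact (hgp x hx y hy fun e => hne (congrArg φ e)).1 h
  · rintro _ ⟨x, hx, rfl⟩ _ ⟨y, hy, rfl⟩ h
    by_contra hne
    exact (hgp x hx y hy fun e => hne (congrArg φ e)).2 h
  · rintro _ ⟨x, hx, rfl⟩
    exact ⟨⟨x, hx⟩, ⟨x, hx⟩, rfl, rfl, .nil, by simp [realLength]⟩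
  · rintro u v r ⟨x, y, hx, hy, p, hp⟩
    exact ⟨y, x, hy, hx, p.reverse, by rwa [realLength_reverse]⟩
  · rintro u v w r s ⟨x, y, hx, hy, p, hp⟩ ⟨y', z, hy', hz, q, hq⟩
    obtain rfl : y = y' := Subtype.ext (hφ.1 (hy.trans hy'.symm))
    exact ⟨x, z, hx, hz, p.append q, by rw [realLength_append]; linarith⟩
  · intro u hu v hv w t s hs h1 h2 hE
    refine hmono _ _ _ _ (edge u hu v hv w t s hs h1 h2 hE) ?_
    apply Real.sqrt_le_iff.mpr
    refine ⟨by positivity, ?_⟩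
    rw [← sq_abs (u.1 - v.1), ← sq_abs (u.2 - v.2)]
    nlinarith [mul_nonneg (abs_nonneg (u.1 - v.1)) (abs_nonneg (u.2 - v.2))]
  · intro u hu v hv w t s hs h1 h2 hE
    refine hmono _ _ _ _ (edge u hu v hv w t s hs h1 h2 hE) ?_
    apply Real.sqrt_le_iff.mpr
    refine ⟨by positivity, ?_⟩
    rw [← sq_abs (u.1 - v.1), ← sq_abs (u.2 - v.2), mul_pow, Real.sq_sqrt (by norm_num)]
    have := pow_le_pow_left₀ (abs_nonneg _) (le_max_left |u.1 - v.1| |u.2 - v.2|) 2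
    have := pow_le_pow_left₀ (abs_nonneg _) (le_max_right |u.1 - v.1| |u.2 - v.2|) 2
    linarith

lemma stretchFactor_delaunay_le {V : Finset Plane} {d : Plane → Plane → ℝ} {φ : Plane → ℝ × ℝ}
    {k : ℝ} (hk : 0 < k) (hφ : Function.Bijective φ)
    (hdist : ∀ u v, dist u v = √(((φ u).1 - (φ v).1) ^ 2 + ((φ u).2 - (φ v).2) ^ 2))
    (hd : ∀ u v, d u v = k * max |(φ u).1 - (φ v).1| |(φ u).2 - (φ v).2|)
    (hgp : ∀ u ∈ V, ∀ v ∈ V, u ≠ v → (φ u).1 ≠ (φ v).1 ∧ (φ u).2 ≠ (φ v).2) :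
    stretchFactor (delaunay d V) ≤ ENNReal.ofReal (√(4 + 2 * √2)) := by
  refine stretchFactor_le fun u v => ?_
  obtain ⟨x, y, hx, hy, p, hp⟩ := (net_delaunay hk hφ hdist hd hgp).path
    ⟨(u : Plane), u.2, rfl⟩ ⟨(v : Plane), v.2, rfl⟩
  obtain rfl : x = u := Subtype.ext (hφ.1 hx)
  obtain rfl : y = v := Subtype.ext (hφ.1 hy)
  exact ⟨p, by rw [hdist]; exact hp.trans (bound_le _ _)⟩

/-! ### The two coordinate systems -/

/-- Cartesian coordinates. -/
def coords (u : Plane) : ℝ × ℝ := (u 0, u 1)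

/-- Coordinates with respect to the axes turned by 45°. -/
noncomputable def diagCoords (u : Plane) : ℝ × ℝ := ((u 0 + u 1) / √2, (u 0 - u 1) / √2)

lemma bijective_coords : Function.Bijective coords := by
  refine ⟨fun u v h => ?_, fun p => ⟨!₂[p.1, p.2], by simp [coords]⟩⟩
  simp only [coords, Prod.mk.injEq] at h
  ext i
  fin_cases i
  · exact h.1
  · exact h.2

lemma bijective_diagCoords : Function.Bijective diagCoords := by
  have h2 : √2 ≠ 0 := by positivity
  refine ⟨fun u v h => ?_, fun p => ⟨!₂[√2 * (p.1 + p.2) / 2, √2 * (p.1 - p.2) / 2], ?_⟩⟩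
  · simp only [diagCoords, Prod.mk.injEq, div_left_inj' h2] at h
    ext i
    fin_cases i
    · simp only [Fin.zero_eta]; linarith
    · simp only [Fin.mk_one]; linarith
  · ext
    · simp [diagCoords]; field_simp; ring
    · simp [diagCoords]; field_simp; ring

lemma dist_eq_coords (u v : Plane) : dist u v =
    √(((coords u).1 - (coords v).1) ^ 2 + ((coords u).2 - (coords v).2) ^ 2) := by
  rw [EuclideanSpace.dist_eq, Fin.sum_univ_two, Real.dist_eq, Real.dist_eq, sq_abs, sq_abs]
  rfl

lemma dist_eq_diagCoords (u v : Plane) : dist u v =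
    √(((diagCoords u).1 - (diagCoords v).1) ^ 2 + ((diagCoords u).2 - (diagCoords v).2) ^ 2) := by
  rw [EuclideanSpace.dist_eq, Fin.sum_univ_two, Real.dist_eq, Real.dist_eq, sq_abs, sq_abs]
  congr 1
  simp only [diagCoords]
  rw [← sub_div, ← sub_div, div_pow, div_pow, Real.sq_sqrt (by norm_num)]
  ring

lemma distInf_eq_coords (u v : Plane) : distInf u v =
    1 * max |(coords u).1 - (coords v).1| |(coords u).2 - (coords v).2| := by
  rw [one_mul]; rfl

/-- This is |x| + |y| = max(|x + y|, |x - y|); the factor √2 undoes the normalisation of the turned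
axes. -/
lemma distOne_eq_diagCoords (u v : Plane) : distOne u v =
    √2 * max |(diagCoords u).1 - (diagCoords v).1| |(diagCoords u).2 - (diagCoords v).2| := by
  have h2 : 0 < √2 := by positivity
  simp only [diagCoords, distOne]
  rw [← sub_div, ← sub_div, abs_div, abs_div, abs_of_pos h2, max_div_div_right h2.le,
    mul_div_cancel₀ _ h2.ne']
  have e1 : u 0 + u 1 - (v 0 + v 1) = (u 0 - v 0) + (u 1 - v 1) := by ring
  have e2 : u 0 - u 1 - (v 0 - v 1) = (u 0 - v 0) - (u 1 - v 1) := by ring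
  rw [e1, e2]
  generalize u 0 - v 0 = x
  generalize u 1 - v 1 = y
  apply le_antisymm
  · rcases abs_cases x with ⟨h, _⟩ | ⟨h, _⟩ <;> rcases abs_cases y with ⟨h', _⟩ | ⟨h', _⟩ <;>
      rw [h, h']
    · exact le_max_of_le_left (le_abs.mpr (Or.inl (by linarith)))
    · exact le_max_of_le_right (le_abs.mpr (Or.inl (by linarith)))
    · exact le_max_of_le_right (le_abs.mpr (Or.inr (by linarith)))
    · exact le_max_of_le_left (le_abs.mpr (Or.inr (by linarith)))
  · exact max_le (abs_add_le x y) (abs_sub x y)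

end SquareDelaunay

theorem mainTheorem2 (P : Finset SquareDelaunay.Plane) :
    (SquareDelaunay.GeneralPositionOne P →
      SquareDelaunay.stretchFactor (SquareDelaunay.delaunayOne P) ≤
        ENNReal.ofReal (Real.sqrt (4 + 2 * Real.sqrt 2))) ∧
    (SquareDelaunay.GeneralPositionInf P →
      SquareDelaunay.stretchFactor (SquareDelaunay.delaunayInf P) ≤
        ENNReal.ofReal (Real.sqrt (4 + 2 * Real.sqrt 2))) := by
  constructor
  · rintro ⟨-, h⟩
    have h2 : √2 ≠ 0 := by positivity
    refine SquareDelaunay.stretchFactor_delaunay_le (by positivity)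
      SquareDelaunay.bijective_diagCoords SquareDelaunay.dist_eq_diagCoords
      SquareDelaunay.distOne_eq_diagCoords fun u hu v hv hne => ?_
    simp only [SquareDelaunay.diagCoords, ne_eq, div_left_inj' h2]
    exact h u hu v hv hne
  · rintro ⟨-, h⟩
    exact SquareDelaunay.stretchFactor_delaunay_le one_pos SquareDelaunay.bijective_coords
      SquareDelaunay.dist_eq_coords SquareDelaunay.distInf_eq_coords h
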